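/- A term over Boolean variables $x_1,\dots,x_n$ is a conjunction of literals in which no variable occurs more than once. A decision list $L$ on $n$ variables with values in a set $V$ is a nonempty sequence of rules $(C_1,v_1),\dots,(C_m,v_m)$, where each $C_i$ is a term, $v_i\in V$ and $C_m\equiv\mathrm{True}$ (the default rule). It computes the function $L:\{0,1\}^n\to V$ with $L(x)=v_i$ for the least $i$ with $C_i(x)=\mathrm{True}$. Its size is $m$, and it is a width-$w$ decision list if every $C_i$ contains at most $w$ literals. For $J\subseteq\{1,\dots,m\}$ with $m\in J$, the sub-decision list $L|_J$ consists of the rules with index in $J$, in their original order. A decision list $L'$ on the same variables $\varepsilon$-approximates $L$ if $\Pr_x[L(x)\ne L'(x)]\le\varepsilon$ for uniformly random $x\in\{0,1\}^n$. Logarithms are to base $2$. (1) There is an absolute constant $C>0$ such that for all integers $w\ge1$, all $0<\varepsilon\le1$ and every width-$w$ decision list $L$ (on any number of variables, of any size $m$, with values in any set $V$) there is $J\subseteq\{1,\dots,m\}$ with $m\in J$ such that $L|_J$ is a width-$w$ decision list of size $$|J|\le\Bigl(2+\tfrac1w\log\tfrac1\varepsilon\Bigr)^{Cw}$$ which $\varepsilon$-approximates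 $L$. (2) This bound is optimal up to the constant in the exponent: there is an absolute constant $c>0$ such that for all integers $w\ge1$ and all $0<\varepsilon\le\tfrac13$ there is a width-$w$ decision list $L$, on some number of variables and with values in $\{0,1\}$, such that every width-$w$ decision list $L'$ on the same variables with values in $\{0,1\}$ (not necessarily a sub-decision list of $L$) that $\varepsilon$-approximates $L$ has size greater than $\bigl(2+\tfrac1w\log\tfrac1\varepsilon\bigr)^{cw}$. -/

import Mathlib

/-- A term over the Boolean variables `x₁, …, xₙ`: a conjunction of literals in which no variable
occurs more than once. `C i = some true` means that the literal `xᵢ` occurs in the term,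
`C i = some false` that `¬ xᵢ` occurs, and `C i = none` that the variable `xᵢ` does not occur. -/
def ConjTerm (n : ℕ) : Type := Fin n → Option Bool

namespace ConjTerm

/-- The term is true on the input `x`: all its literals are. -/
def Sat {n : ℕ} (C : ConjTerm n) (x : Fin n → Bool) : Prop :=
  ∀ i : Fin n, ∀ b : Bool, C i = some b → x i = b

instance {n : ℕ} (C : ConjTerm n) (x : Fin n → Bool) : Decidable (C.Sat x) := by
  unfold Sat
  infer_instance

/-- The number of literals (equivalently, of variables) in a term. -/
def width {n : ℕ} (C : ConjTerm n) : ℕ :=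
  (Finset.univ.filter (fun i : Fin n => (C i).isSome = true)).card

end ConjTerm

/-- A decision list on `n` Boolean variables with values in `V`: a nonempty list of rules
`(term i, value i)`, whose last rule is a default rule, its term being identically true. -/
structure DecisionList (n : ℕ) (V : Type*) where
  /-- the number of rules -/
  size : ℕ
  size_pos : 0 < size
  term : Fin size → ConjTerm n
  value : Fin size → V
  default_sat : ∀ x : Fin n → Bool, (term ⟨size - 1, Nat.sub_one_lt_of_lt size_pos⟩).Sat x

namespace DecisionList

variable {n : ℕ} {V : Type*}

/-- The index of the last (default) rule. -/
def last (L : DecisionList n V) : Fin L.size :=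
  ⟨L.size - 1, Nat.sub_one_lt_of_lt L.size_pos⟩

/-- The maximal number of variables in a term of the decision list. -/
def width (L : DecisionList n V) : ℕ :=
  Finset.univ.sup (fun i : Fin L.size => (L.term i).width)

/-- The rules whose terms are satisfied by `x`; the default rule is among them. -/
def satisfied (L : DecisionList n V) (x : Fin n → Bool) : Finset (Fin L.size) :=
  Finset.univ.filter (fun i : Fin L.size => (L.term i).Sat x)

theorem satisfied_nonempty (L : DecisionList n V) (x : Fin n → Bool) :
    (L.satisfied x).Nonempty :=
  ⟨L.last, Finset.mem_filter.mpr ⟨Finset.mem_univ _, L.default_sat x⟩⟩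

/-- The index of the first rule whose term is satisfied by `x`. -/
def index (L : DecisionList n V) (x : Fin n → Bool) : Fin L.size :=
  (L.satisfied x).min' (L.satisfied_nonempty x)

/-- The output of the decision list: the value of the first rule whose term is satisfied. -/
def eval (L : DecisionList n V) (x : Fin n → Bool) : V :=
  L.value (L.index x)

theorem orderEmb_last (L : DecisionList n V) (J : Finset (Fin L.size)) (hJ : L.last ∈ J)
    (h : J.card - 1 < J.card) : J.orderEmbOfFin rfl ⟨J.card - 1, h⟩ = L.last := by
  rw [Finset.orderEmbOfFin_last rfl (by omega)]
  apply le_antisymm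
  · have hlt := (J.max' ⟨L.last, hJ⟩).isLt
    exact Fin.le_def.mpr (Nat.le_sub_one_of_lt hlt)
  · exact Finset.le_max' J _ hJ

/-- The sub-decision list keeping exactly the rules with index in `J`, in their original order;
the default rule has to be kept. -/
def restrict (L : DecisionList n V) (J : Finset (Fin L.size)) (hJ : L.last ∈ J) :
    DecisionList n V where
  size := J.card
  size_pos := Finset.card_pos.mpr ⟨_, hJ⟩
  term := fun k => L.term (J.orderEmbOfFin rfl k)
  value := fun k => L.value (J.orderEmbOfFin rfl k)
  default_sat := fun x => by
    rw [L.orderEmb_last J hJ]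
    exact L.default_sat x

open Classical in
/-- The probability that the outputs of `L` and `L'` differ on a uniformly random input. -/
noncomputable def disagreement (L L' : DecisionList n V) : ℝ :=
  ((Finset.univ.filter (fun x : Fin n → Bool => L.eval x ≠ L'.eval x)).card : ℝ) / 2 ^ n

/-- `L'` `ε`-approximates `L`: they differ on at most an `ε` fraction of the inputs. -/
def Approximates (ε : ℝ) (L' L : DecisionList n V) : Prop :=
  L.disagreement L' ≤ ε

end DecisionList

/-! Upper bound. Let `p i` be the probability that rule `i` is the first satisfied one. Take a
random restriction `ρ` that fixes each coordinate with probability `τ`, to a uniform bit. Say that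
`ρ` selects rule `i` if it makes the term of `i` true and is consistent with an input whose first
satisfied rule is `i`. No `ρ` selects two rules (`forcesAndHits_unique`), while rule `i` is selected
with probability at least `(τ/2)^w * p i ^ τ` (`le_hitProb`). Hence `∑ p i ^ τ ≤ (2/τ)^w` for every
`0 < τ ≤ 1` (`sum_indexProb_rpow_le`). Keep the default rule and the rules with `p i` above a
threshold: the bound with small `τ` controls how many there are, and the bound with `τ = 1/2`
controls the total probability of the others.

Lower bound, by counting. There are at most `(2 * (2n+1)^w)^s` functions with width-`w` lists of
size at most `s` (`exists_finset_eval`). For moderate `ε`, every function of `w` variables has a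
width-`w` list, and small lists cannot cover all of these functions by Hamming balls of radius
`1/3`. For very small `ε`, approximation means equality, and the disjunctions of transversal terms
over `w` blocks of `q` variables already give `2^(q^w)` functions. -/

/-! ### Random restrictions, one coordinate at a time. -/

/-- The probability that a random restriction treats a coordinate in a given way: the coordinate is
left free with probability `1 - τ`, and fixed to each of the two bits with probability `τ / 2`. -/
noncomputable def restrictionProb (τ : ℝ) : Option Bool → ℝ
  | none => 1 - τ
  | some _ => τ / 2

theorem restrictionProb_nonneg {τ : ℝ} (h0 : 0 ≤ τ) (h1 : τ ≤ 1) (o : Option Bool) :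
    0 ≤ restrictionProb τ o := by
  cases o
  · simpa [restrictionProb] using h1
  · simp only [restrictionProb]; positivity

theorem sum_prod_restrictionProb (τ : ℝ) (n : ℕ) :
    ∑ ρ : Fin n → Option Bool, ∏ i, restrictionProb τ (ρ i) = 1 := by
  rw [← Fintype.prod_sum (fun (_ : Fin n) o => restrictionProb τ o)]
  apply Finset.prod_eq_one
  intro i _
  rw [Fintype.sum_option, Fintype.sum_bool]
  simp only [restrictionProb]
  ring

/-- The restriction `ρ` fixes all literals of `C` to true, and some point of `A` is consistent
with `ρ`. -/
def ForcesAndHits {n : ℕ} (C : ConjTerm n) (A : Finset (Fin n → Bool)) (ρ : Fin n → Option Bool) :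
    Prop :=
  (∀ i b, C i = some b → ρ i = some b) ∧ ∃ x ∈ A, ConjTerm.Sat ρ x

open Classical in
/-- The probability of `ForcesAndHits` under a random restriction. -/
noncomputable def hitProb (τ : ℝ) {n : ℕ} (C : ConjTerm n) (A : Finset (Fin n → Bool)) : ℝ :=
  ∑ ρ : Fin n → Option Bool,
    if ForcesAndHits C A ρ then ∏ i, restrictionProb τ (ρ i) else 0

/-- The slice of `A` at which the first coordinate equals `b`. -/
def headSlice {n : ℕ} (A : Finset (Fin (n + 1) → Bool)) (b : Bool) : Finset (Fin n → Bool) :=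
  Finset.univ.filter (fun y => (Fin.cons b y : Fin (n + 1) → Bool) ∈ A)

theorem card_headSlice_add {n : ℕ} (A : Finset (Fin (n + 1) → Bool)) :
    (headSlice A true).card + (headSlice A false).card = A.card := by
  have h : ∀ b, (headSlice A b).card = (A.filter (fun x => x 0 = b)).card := by
    intro b
    refine Finset.card_bij' (fun y _ => Fin.cons b y) (fun x _ => Fin.tail x) ?_ ?_ ?_ ?_
    · intro y hy
      simpa [headSlice] using hy
    · intro x hx
      simp only [Finset.mem_filter] at hx
      obtain ⟨hx, rfl⟩ := hx
      simpa [headSlice] using hx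
    · intro y _
      simp
    · intro x hx
      simp only [Finset.mem_filter] at hx
      obtain ⟨hx, rfl⟩ := hx
      simp
  rw [h, h, ← Finset.card_filter_add_card_filter_not (s := A) (fun x => x 0 = true)]
  simp

theorem ConjTerm.sat_cons_iff {n : ℕ} (o : Option Bool) (σ : Fin n → Option Bool)
    (x : Fin (n + 1) → Bool) :
    ConjTerm.Sat (n := n + 1) (Fin.cons o σ : Fin (n + 1) → Option Bool) x ↔
      (∀ b, o = some b → x 0 = b) ∧ ConjTerm.Sat σ (Fin.tail x) := by
  simp [ConjTerm.Sat, Fin.forall_fin_succ, Fin.tail]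

/-- A free coordinate lets the consistent point take either bit, so the two slices are replaced by
their union. -/
theorem forcesAndHits_cons_none {n : ℕ} (C : ConjTerm (n + 1)) (A : Finset (Fin (n + 1) → Bool))
    (σ : Fin n → Option Bool) :
    ForcesAndHits C A (Fin.cons none σ) ↔
      C 0 = none ∧ ForcesAndHits (n := n) (fun i => C i.succ)
        (headSlice A true ∪ headSlice A false) σ := by
  simp only [ForcesAndHits, Fin.forall_fin_succ, Fin.cons_zero, Fin.cons_succ,
    ConjTerm.sat_cons_iff, Option.eq_none_iff_forall_ne_some]
  constructor
  · rintro ⟨⟨h0, h⟩, x, hx, -, hσ⟩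
    refine ⟨fun b hb => by simpa using h0 b hb, h, Fin.tail x, ?_, hσ⟩
    rcases hb : x 0 with _ | _ <;>
    · have := Fin.cons_self_tail x
      rw [hb] at this
      simp [headSlice, this, hx]
  · rintro ⟨h0, h, y, hy, hσ⟩
    refine ⟨⟨fun b hb => absurd hb (h0 b), h⟩, ?_⟩
    simp only [headSlice, Finset.mem_union, Finset.mem_filter, Finset.mem_univ, true_and] at hy
    rcases hy with hy | hy
    · exact ⟨_, hy, by simp, by simpa using hσ⟩
    · exact ⟨_, hy, by simp, by simpa using hσ⟩

theorem forcesAndHits_cons_some {n : ℕ} (C : ConjTerm (n + 1)) (A : Finset (Fin (n + 1) → Bool))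
    (b : Bool) (σ : Fin n → Option Bool) :
    ForcesAndHits C A (Fin.cons (some b) σ) ↔
      C 0 ≠ some (!b) ∧ ForcesAndHits (n := n) (fun i => C i.succ) (headSlice A b) σ := by
  simp only [ForcesAndHits, Fin.forall_fin_succ, Fin.cons_zero, Fin.cons_succ,
    ConjTerm.sat_cons_iff]
  constructor
  · rintro ⟨⟨h0, h⟩, x, hx, hb, hσ⟩
    refine ⟨fun hc => ?_, h, Fin.tail x, ?_, hσ⟩
    · have := h0 _ hc
      simp at this
    · have hb := hb b rfl
      have := Fin.cons_self_tail x
      rw [hb] at this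
      simp [headSlice, this, hx]
  · rintro ⟨h0, h, y, hy, hσ⟩
    refine ⟨⟨fun b' hb => ?_, h⟩, ?_⟩
    · rw [hb] at h0
      cases b <;> cases b' <;> simp_all
    · simp only [headSlice, Finset.mem_filter, Finset.mem_univ, true_and] at hy
      exact ⟨_, hy, by simp, by simpa using hσ⟩

/-- Condition on how the restriction treats the first coordinate. -/
theorem hitProb_succ (τ : ℝ) {n : ℕ} (C : ConjTerm (n + 1)) (A : Finset (Fin (n + 1) → Bool)) :
    hitProb τ C A =
      (if C 0 = none then (1 - τ) * hitProb τ (n := n) (fun i => C i.succ)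
        (headSlice A true ∪ headSlice A false) else 0) +
      ((if C 0 ≠ some false then τ / 2 * hitProb τ (n := n) (fun i => C i.succ)
        (headSlice A true) else 0) +
      (if C 0 ≠ some true then τ / 2 * hitProb τ (n := n) (fun i => C i.succ)
        (headSlice A false) else 0)) := by
  classical
  unfold hitProb
  rw [← (Fin.consEquiv (fun _ : Fin (n + 1) => Option Bool)).sum_comp, Fintype.sum_prod_type,
    Fintype.sum_option, Fintype.sum_bool]
  have key : ∀ (o : Option Bool) (P : Prop) [Decidable P] (B : Finset (Fin n → Bool)),
      (∀ σ, ForcesAndHits C A (Fin.cons o σ) ↔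
        P ∧ ForcesAndHits (n := n) (fun i => C i.succ) B σ) →
      (∑ σ : Fin n → Option Bool,
        if ForcesAndHits C A (Fin.cons o σ : Fin (n + 1) → Option Bool) then
          ∏ i, restrictionProb τ ((Fin.cons o σ : Fin (n + 1) → Option Bool) i) else 0) =
      if P then restrictionProb τ o * ∑ σ : Fin n → Option Bool,
        (if ForcesAndHits (n := n) (fun i => C i.succ) B σ then
          ∏ i, restrictionProb τ (σ i) else 0) else 0 := by
    intro o P _ B h
    by_cases hP : P
    · simp [h, hP, Finset.mul_sum, Fin.prod_univ_succ]
    · simp [h, hP]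
  exact congrArg₂ (· + ·) (key none _ _ (forcesAndHits_cons_none C A))
    (congrArg₂ (· + ·) (key (some true) _ _ (forcesAndHits_cons_some C A true))
      (key (some false) _ _ (forcesAndHits_cons_some C A false)))

/-! ### Lower bound on the selection probability of a rule. -/

/-- By homogeneity take `a = 1`, `b = c ≤ 1`. Bernoulli's inequality bounds the left side by `1 -
τ/2 + τ/2 * c`, and `c ≤ c ^ τ`. -/
theorem rpow_average_le {τ a b : ℝ} (h0 : 0 < τ) (h1 : τ ≤ 1) (hb : 0 ≤ b) (hab : b ≤ a) :
    ((a + b) / 2) ^ τ ≤ (1 - τ) * a ^ τ + (τ / 2 * a ^ τ + τ / 2 * b ^ τ) := by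
  rcases (hb.trans hab).eq_or_lt with ha | ha
  · subst ha
    have : b = 0 := le_antisymm hab hb
    subst this
    simp [Real.zero_rpow h0.ne']
  obtain ⟨c, rfl⟩ : ∃ c, b = a * c := ⟨b / a, by field_simp⟩
  have hc0 : 0 ≤ c := by
    by_contra! hc
    nlinarith
  have hc1 : c ≤ 1 := by
    by_contra! hc
    nlinarith
  have e : (a + a * c) / 2 = a * (1 + (c - 1) / 2) := by ring
  rw [e, Real.mul_rpow ha.le (by linarith), Real.mul_rpow ha.le hc0]
  have h := rpow_one_add_le_one_add_mul_self (s := (c - 1) / 2) (by linarith) h0.le h1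
  have h' : c ≤ c ^ τ := by
    simpa using Real.rpow_le_rpow_of_exponent_ge' hc0 hc1 h0.le h1
  have ha' : 0 < a ^ τ := Real.rpow_pos_of_pos ha τ
  have : (1 + (c - 1) / 2) ^ τ ≤ 1 - τ / 2 + τ / 2 * c ^ τ := by nlinarith
  nlinarith

theorem ConjTerm.width_succ {n : ℕ} (C : ConjTerm (n + 1)) :
    C.width = (if (C 0).isSome then 1 else 0) +
      ConjTerm.width (n := n) (fun i => C i.succ) := by
  simp only [ConjTerm.width, Finset.card_filter, Fin.sum_univ_succ]

/-- Each literal of `C` costs a factor `τ/2`, the chance of being fixed correctly. On the other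
coordinates a random subcube meets a set of density `p` with probability at least `p ^ τ`, by
induction with `rpow_average_le` as the two-point inequality. -/
theorem le_hitProb {τ : ℝ} (h0 : 0 < τ) (h1 : τ ≤ 1) {n : ℕ} (C : ConjTerm n)
    (A : Finset (Fin n → Bool)) (hA : ∀ x ∈ A, C.Sat x) :
    (τ / 2) ^ C.width * ((A.card : ℝ) / 2 ^ n) ^ τ ≤ hitProb τ C A := by
  induction n with
  | zero =>
    have hw : C.width = 0 := by simp [ConjTerm.width]
    rcases A.eq_empty_or_nonempty with rfl | ⟨x, hx⟩
    · simp [hw, Real.zero_rpow h0.ne', hitProb, ForcesAndHits]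
    · have hA1 : A = {x} := by
        ext y
        simp [Subsingleton.elim y x, hx]
      have : ∀ ρ, ForcesAndHits C A ρ := fun ρ => ⟨fun i => i.elim0, x, hx, fun i => i.elim0⟩
      rw [hitProb, Fintype.sum_unique, if_pos (this _)]
      simp [hw, hA1]
  | succ n ih =>
    set C' : ConjTerm n := fun i => C i.succ with hC'
    set A1 := headSlice A true with hA1
    set A0 := headSlice A false with hA0
    have hS : ∀ b, ∀ y ∈ headSlice A b, C'.Sat y ∧ (∀ b', C 0 = some b' → b' = b) := by
      intro b y hy
      simp only [headSlice, Finset.mem_filter, Finset.mem_univ, true_and] at hy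
      have := hA _ hy
      refine ⟨fun i b' hb => by simpa using this i.succ b' hb, fun b' hb => ?_⟩
      simpa using (this 0 b' hb).symm
    have i1 := ih C' A1 fun y hy => (hS _ y hy).1
    have i0 := ih C' A0 fun y hy => (hS _ y hy).1
    have iu := ih C' (A1 ∪ A0) fun y hy => by
      rcases Finset.mem_union.1 hy with h | h
      exacts [(hS _ y h).1, (hS _ y h).1]
    have hcard : (A.card : ℝ) = A1.card + A0.card := by
      rw [← card_headSlice_add A]
      push_cast
      rfl
    have c1 : (A1.card : ℝ) ≤ (A1 ∪ A0).card := by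
      exact_mod_cast Finset.card_le_card Finset.subset_union_left
    have c0 : (A0.card : ℝ) ≤ (A1 ∪ A0).card := by
      exact_mod_cast Finset.card_le_card Finset.subset_union_right
    rw [hitProb_succ, ConjTerm.width_succ, ← hC', ← hA1, ← hA0]
    have hT : 0 < (τ / 2) ^ C'.width := by positivity
    have hdec : ∀ {u v : ℝ}, 0 ≤ u → u ≤ 2 * v → (u / 2 ^ (n + 1)) ^ τ ≤ (v / 2 ^ n) ^ τ := by
      intro u v hu huv
      apply Real.rpow_le_rpow (by positivity) _ h0.le
      rw [div_le_div_iff₀ (by positivity) (by positivity), pow_succ]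
      have : (0 : ℝ) < 2 ^ n := by positivity
      nlinarith
    rcases hc : C 0 with _ | b
    · simp only [Option.isSome_none, Bool.false_eq_true, if_false, zero_add, if_true, ne_eq,
        reduceCtorEq, not_false_eq_true]
      have key : ((A.card : ℝ) / 2 ^ (n + 1)) ^ τ ≤
          (1 - τ) * (((A1 ∪ A0).card : ℝ) / 2 ^ n) ^ τ +
          (τ / 2 * ((A1.card : ℝ) / 2 ^ n) ^ τ + τ / 2 * ((A0.card : ℝ) / 2 ^ n) ^ τ) := by
        -- The averaging inequality is applied with the denser slice as `a`; the union is at least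
        -- as dense and replaces it in the free term.
        have hmono : ∀ {u : ℝ}, 0 ≤ u → u ≤ (A1 ∪ A0).card →
            (1 - τ) * (u / 2 ^ n) ^ τ ≤ (1 - τ) * (((A1 ∪ A0).card : ℝ) / 2 ^ n) ^ τ := by
          intro u hu huv
          apply mul_le_mul_of_nonneg_left _ (by linarith)
          exact Real.rpow_le_rpow (by positivity) (by gcongr) h0.le
        rcases le_total (A0.card : ℝ) A1.card with hle | hle
        · have := rpow_average_le (a := (A1.card : ℝ) / 2 ^ n) (b := (A0.card : ℝ) / 2 ^ n) h0 h1
            (by positivity) (by gcongr)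
          have e : ((A1.card : ℝ) / 2 ^ n + (A0.card : ℝ) / 2 ^ n) / 2 = A.card / 2 ^ (n + 1) := by
            rw [hcard, pow_succ]; field_simp
          rw [e] at this
          linarith [hmono (by positivity) c1]
        · have := rpow_average_le (a := (A0.card : ℝ) / 2 ^ n) (b := (A1.card : ℝ) / 2 ^ n) h0 h1
            (by positivity) (by gcongr)
          have e : ((A0.card : ℝ) / 2 ^ n + (A1.card : ℝ) / 2 ^ n) / 2 = A.card / 2 ^ (n + 1) := by
            rw [hcard, pow_succ]; field_simp; ring
          rw [e] at this
          linarith [hmono (by positivity) c0]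
      have k1 := mul_le_mul_of_nonneg_left key hT.le
      have k2 := mul_le_mul_of_nonneg_left iu (sub_nonneg.2 h1)
      have k3 := mul_le_mul_of_nonneg_left i1 (half_pos h0).le
      have k4 := mul_le_mul_of_nonneg_left i0 (half_pos h0).le
      linarith
    -- All points of `A` satisfy the literal, so one slice is empty and the other has twice the
    -- density of `A`.
    · have hzero : ∀ b', b' ≠ b → (headSlice A b').card = 0 := by
        intro b' hb'
        rw [Finset.card_eq_zero, Finset.eq_empty_iff_forall_notMem]
        intro y hy
        exact hb' ((hS b' y hy).2 b hc).symm
      cases b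
      · have hz : (A1.card : ℝ) = 0 := by exact_mod_cast hzero true (by simp)
        rw [hz, zero_add] at hcard
        simp [pow_add]
        have := hdec (u := A.card) (v := A0.card) (by positivity) (by rw [hcard]; linarith [(Nat.cast_nonneg A0.card : (0:ℝ) ≤ _)])
        calc τ / 2 * (τ / 2) ^ C'.width * ((A.card : ℝ) / 2 ^ (n + 1)) ^ τ
            ≤ τ / 2 * (τ / 2) ^ C'.width * ((A0.card : ℝ) / 2 ^ n) ^ τ := by gcongr
          _ = τ / 2 * ((τ / 2) ^ C'.width * ((A0.card : ℝ) / 2 ^ n) ^ τ) := by ring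
          _ ≤ _ := by gcongr
      · have hz : (A0.card : ℝ) = 0 := by exact_mod_cast hzero false (by simp)
        rw [hz, add_zero] at hcard
        simp [pow_add]
        have := hdec (u := A.card) (v := A1.card) (by positivity) (by rw [hcard]; linarith [(Nat.cast_nonneg A1.card : (0:ℝ) ≤ _)])
        calc τ / 2 * (τ / 2) ^ C'.width * ((A.card : ℝ) / 2 ^ (n + 1)) ^ τ
            ≤ τ / 2 * (τ / 2) ^ C'.width * ((A1.card : ℝ) / 2 ^ n) ^ τ := by gcongr
          _ = τ / 2 * ((τ / 2) ^ C'.width * ((A1.card : ℝ) / 2 ^ n) ^ τ) := by ring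
          _ ≤ _ := by gcongr

/-! ### The upper bound: keeping the likely rules. -/

namespace DecisionList

/-- The inputs on which rule `i` is the first satisfied one. -/
def indexFiber {n : ℕ} {V : Type*} (L : DecisionList n V) (i : Fin L.size) :
    Finset (Fin n → Bool) :=
  Finset.univ.filter (fun x => L.index x = i)

/-- The probability that rule `i` is the first satisfied one on a uniformly random input. -/
noncomputable def indexProb {n : ℕ} {V : Type*} (L : DecisionList n V) (i : Fin L.size) : ℝ :=
  ((L.indexFiber i).card : ℝ) / 2 ^ n

theorem indexProb_nonneg {n : ℕ} {V : Type*} (L : DecisionList n V) (i : Fin L.size) :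
    0 ≤ L.indexProb i := by
  unfold indexProb
  positivity

theorem sat_index {n : ℕ} {V : Type*} (L : DecisionList n V) (x : Fin n → Bool) :
    (L.term (L.index x)).Sat x :=
  (Finset.mem_filter.1 (Finset.min'_mem (L.satisfied x) (L.satisfied_nonempty x))).2

theorem index_le {n : ℕ} {V : Type*} (L : DecisionList n V) {x : Fin n → Bool} {i : Fin L.size}
    (h : (L.term i).Sat x) : L.index x ≤ i :=
  Finset.min'_le (L.satisfied x) _ (Finset.mem_filter.2 ⟨Finset.mem_univ _, h⟩)

/-- If `ρ` forces the term of `i`, then a point of the fiber of `j` consistent with `ρ` satisfies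
that term, so `j ≤ i`. Exchange the roles. -/
theorem forcesAndHits_unique {n : ℕ} {V : Type*} (L : DecisionList n V) {i j : Fin L.size}
    {ρ : Fin n → Option Bool} (hi : ForcesAndHits (L.term i) (L.indexFiber i) ρ)
    (hj : ForcesAndHits (L.term j) (L.indexFiber j) ρ) : i = j := by
  have key : ∀ {i j : Fin L.size}, ForcesAndHits (L.term i) (L.indexFiber i) ρ →
      ForcesAndHits (L.term j) (L.indexFiber j) ρ → j ≤ i := by
    rintro i j ⟨hi, -⟩ ⟨-, x, hx, hρ⟩
    rw [← (Finset.mem_filter.1 hx).2]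
    exact L.index_le fun k b hk => hρ k b (hi k b hk)
  exact le_antisymm (key hj hi) (key hi hj)

theorem sum_hitProb_le_one {n : ℕ} {V : Type*} (L : DecisionList n V) {τ : ℝ} (h0 : 0 ≤ τ)
    (h1 : τ ≤ 1) : ∑ i, hitProb τ (L.term i) (L.indexFiber i) ≤ 1 := by
  classical
  unfold hitProb
  rw [Finset.sum_comm, ← sum_prod_restrictionProb τ n]
  apply Finset.sum_le_sum
  intro ρ _
  have hp : 0 ≤ ∏ i, restrictionProb τ (ρ i) :=
    Finset.prod_nonneg fun i _ => restrictionProb_nonneg h0 h1 _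
  by_cases h : ∃ i, ForcesAndHits (L.term i) (L.indexFiber i) ρ
  · obtain ⟨i, hi⟩ := h
    rw [Finset.sum_eq_single i]
    · simp [hi]
    · intro j _ hj
      rw [if_neg fun h => hj (L.forcesAndHits_unique h hi)]
    · simp
  · push Not at h
    simpa [h] using hp

theorem sum_indexProb_rpow_le {n : ℕ} {V : Type*} (L : DecisionList n V) {w : ℕ}
    (hw : L.width ≤ w) {τ : ℝ} (h0 : 0 < τ) (h1 : τ ≤ 1) :
    ∑ i, L.indexProb i ^ τ ≤ (2 / τ) ^ w := by
  have h : (τ / 2) ^ w * ∑ i, L.indexProb i ^ τ ≤ 1 := by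
    refine le_trans ?_ (L.sum_hitProb_le_one h0.le h1)
    rw [Finset.mul_sum]
    apply Finset.sum_le_sum
    intro i _
    have hi : (L.term i).width ≤ w :=
      (Finset.le_sup (f := fun i => (L.term i).width) (Finset.mem_univ i)).trans hw
    refine le_trans ?_ (le_hitProb h0 h1 (L.term i) (L.indexFiber i) ?_)
    · apply mul_le_mul_of_nonneg_right _ (Real.rpow_nonneg (L.indexProb_nonneg i) _)
      exact pow_le_pow_of_le_one (by positivity) (by linarith) hi
    · intro x hx
      rw [← (Finset.mem_filter.1 hx).2]
      exact L.sat_index x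
  have e : (2 / τ) ^ w = ((τ / 2) ^ w)⁻¹ := by rw [← inv_pow, inv_div]
  rw [e, ← one_div, le_div_iff₀ (by positivity)]
  linarith

theorem restrict_eval {n : ℕ} {V : Type*} (L : DecisionList n V) {J : Finset (Fin L.size)}
    (hJ : L.last ∈ J) {x : Fin n → Bool} (hx : L.index x ∈ J) :
    (L.restrict J hJ).eval x = L.eval x := by
  set M := L.restrict J hJ with hM
  obtain ⟨k, hk⟩ : ∃ k : Fin J.card, J.orderEmbOfFin rfl k = L.index x := by
    have : L.index x ∈ Set.range (J.orderEmbOfFin rfl) := by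
      rw [Finset.range_orderEmbOfFin]
      exact hx
    exact this
  have h1 : M.index x ≤ k := by
    apply M.index_le
    change (L.term (J.orderEmbOfFin rfl k)).Sat x
    rw [hk]
    exact L.sat_index x
  have h2 : L.index x ≤ J.orderEmbOfFin rfl (M.index x) := L.index_le (M.sat_index x)
  have h3 : M.index x = k := by
    apply le_antisymm h1
    rw [← hk] at h2
    exact (J.orderEmbOfFin rfl).le_iff_le.1 h2
  change L.value (J.orderEmbOfFin rfl (M.index x)) = L.value (L.index x)
  rw [h3, hk]

theorem restrict_width_le {n : ℕ} {V : Type*} (L : DecisionList n V) {J : Finset (Fin L.size)}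
    (hJ : L.last ∈ J) : (L.restrict J hJ).width ≤ L.width := by
  apply Finset.sup_le
  intro k _
  exact Finset.le_sup (f := fun i => (L.term i).width) (Finset.mem_univ (J.orderEmbOfFin rfl k))

theorem disagreement_restrict_le {n : ℕ} {V : Type*} (L : DecisionList n V)
    {J : Finset (Fin L.size)} (hJ : L.last ∈ J) :
    L.disagreement (L.restrict J hJ) ≤ ∑ i ∈ Jᶜ, L.indexProb i := by
  classical
  unfold disagreement indexProb
  rw [← Finset.sum_div]
  gcongr
  rw [← Nat.cast_sum]
  gcongr
  refine le_trans (Finset.card_le_card ?_) Finset.card_biUnion_le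
  intro x hx
  rw [Finset.mem_filter] at hx
  simp only [Finset.mem_biUnion, Finset.mem_compl]
  exact ⟨L.index x, fun h => hx.2 (L.restrict_eval hJ h).symm,
    Finset.mem_filter.2 ⟨Finset.mem_univ _, rfl⟩⟩

theorem exists_restrict_approximates {n : ℕ} {V : Type*} (L : DecisionList n V) {w : ℕ}
    (hw1 : 1 ≤ w) (hw : L.width ≤ w) {ε : ℝ} (h0 : 0 < ε) (h1 : ε ≤ 1) :
    ∃ (J : Finset (Fin L.size)) (hJ : L.last ∈ J), (L.restrict J hJ).width ≤ w ∧
      ((L.restrict J hJ).size : ℝ) ≤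
        (2 + 1 / (w : ℝ) * Real.logb 2 (1 / ε)) ^ (5 * (w : ℝ)) ∧
      Approximates ε (L.restrict J hJ) L := by
  classical
  have hwpos : (0 : ℝ) < w := by exact_mod_cast hw1
  set k : ℝ := 1 / (w : ℝ) * Real.logb 2 (1 / ε) with hk
  have hk0 : 0 ≤ k := by
    have : 0 ≤ Real.logb 2 (1 / ε) :=
      Real.logb_nonneg (by norm_num) ((one_le_div h0).2 h1)
    positivity
  have hε : ε = (2 : ℝ) ^ (-(k * w)) := by
    have : k * w = - Real.logb 2 ε := by
      rw [hk, one_div ε, Real.logb_inv]; field_simp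
    rw [this, neg_neg, Real.rpow_logb (by norm_num) (by norm_num) h0]
  -- With this threshold, `t^(1/2) * 4^w = 2^(-k*w) = ε` is the error bound for the discarded rules.
  set t : ℝ := (2 : ℝ) ^ (-((2 * k + 4) * w)) with ht
  have htpos : 0 < t := by positivity
  set K : Finset (Fin L.size) := Finset.univ.filter (fun i => t ≤ L.indexProb i) with hK
  have hJ : L.last ∈ insert L.last K := Finset.mem_insert_self _ _
  refine ⟨insert L.last K, hJ, (L.restrict_width_le hJ).trans hw, ?_, ?_⟩
  -- Chosen so that `(2k+4) * τ = 2`: then `t^τ = 4^(-w)`, and the threshold costs only a constant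
  -- factor per unit of width.
  · set τ : ℝ := 1 / (2 + k) with hτ
    have hτ0 : 0 < τ := by positivity
    have hτ1 : τ ≤ 1 := by rw [hτ, div_le_one (by positivity)]; linarith
    have hsum := L.sum_indexProb_rpow_le hw hτ0 hτ1
    have hKt : (K.card : ℝ) * t ^ τ ≤ (2 / τ) ^ w := by
      refine le_trans ?_ hsum
      rw [← nsmul_eq_mul]
      refine le_trans (Finset.card_nsmul_le_sum K (fun i => L.indexProb i ^ τ) _ ?_) ?_
      · intro i hi
        exact Real.rpow_le_rpow htpos.le (Finset.mem_filter.1 hi).2 hτ0.le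
      · exact Finset.sum_le_sum_of_subset_of_nonneg (Finset.subset_univ _)
          fun i _ _ => Real.rpow_nonneg (L.indexProb_nonneg i) _
    have htτ : t ^ τ = ((4 : ℝ) ^ w)⁻¹ := by
      rw [ht, ← Real.rpow_mul (by norm_num)]
      have : -((2 * k + 4) * (w : ℝ)) * τ = -((2 * w : ℕ) : ℝ) := by
        rw [hτ]; push_cast; field_simp; ring
      rw [this, Real.rpow_neg (by norm_num), Real.rpow_natCast, pow_mul]
      norm_num
    have h2τ : 2 / τ = 2 * (2 + k) := by rw [hτ]; field_simp
    rw [htτ, h2τ, ← div_eq_mul_inv, div_le_iff₀ (by positivity), ← mul_pow] at hKt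
    have hcard : ((L.restrict (insert L.last K) hJ).size : ℝ) ≤ K.card + 1 := by
      have := Finset.card_insert_le L.last K
      exact_mod_cast this
    -- The extra 1 for the default rule is absorbed into a factor `2 ≤ 2^w`; then `2 * 2 * 4 = 2^4 ≤
    -- (2+k)^4` gives the exponent 5.
    have hb : (1 : ℝ) ≤ (2 * (2 + k) * 4) ^ w := one_le_pow₀ (by linarith)
    have h2w : (2 : ℝ) ≤ 2 ^ w := by simpa using pow_le_pow_right₀ (by norm_num : (1:ℝ) ≤ 2) hw1
    calc ((L.restrict (insert L.last K) hJ).size : ℝ) ≤ K.card + 1 := hcard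
      _ ≤ 2 * (2 * (2 + k) * 4) ^ w := by linarith
      _ ≤ 2 ^ w * (2 * (2 + k) * 4) ^ w := by gcongr
      _ = (2 ^ 4 * (2 + k)) ^ w := by rw [← mul_pow]; ring
      _ ≤ ((2 + k) ^ 4 * (2 + k)) ^ w := by gcongr; linarith
      _ = (2 + k) ^ (5 * w) := by rw [← pow_succ, ← pow_mul]
      _ = (2 + k) ^ (5 * (w : ℝ)) := by
        rw [← Real.rpow_natCast]; push_cast; rfl
  · refine le_trans (L.disagreement_restrict_le hJ) ?_
    have hsum := L.sum_indexProb_rpow_le hw (τ := 1 / 2) (by norm_num) (by norm_num)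
    have hle : ∀ i ∈ (insert L.last K)ᶜ,
        L.indexProb i ≤ t ^ (1 / 2 : ℝ) * L.indexProb i ^ (1 / 2 : ℝ) := by
      intro i hi
      have hi : L.indexProb i < t := by
        by_contra! h
        exact Finset.mem_compl.1 hi
          (Finset.mem_insert_of_mem (Finset.mem_filter.2 ⟨Finset.mem_univ _, h⟩))
      have hi0 := L.indexProb_nonneg i
      calc L.indexProb i = L.indexProb i ^ (1 / 2 : ℝ) * L.indexProb i ^ (1 / 2 : ℝ) := by
            rw [← Real.sqrt_eq_rpow, Real.mul_self_sqrt hi0]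
        _ ≤ _ := by gcongr
    refine (Finset.sum_le_sum hle).trans ?_
    rw [← Finset.mul_sum]
    have hall : ∑ i ∈ (insert L.last K)ᶜ, L.indexProb i ^ (1 / 2 : ℝ) ≤ (4 : ℝ) ^ w := by
      refine (Finset.sum_le_sum_of_subset_of_nonneg (Finset.subset_univ _)
        fun i _ _ => Real.rpow_nonneg (L.indexProb_nonneg i) _).trans (hsum.trans ?_)
      norm_num
    refine (mul_le_mul_of_nonneg_left hall (by positivity)).trans (le_of_eq ?_)
    have h4 : (4 : ℝ) ^ w = (2 : ℝ) ^ (2 * (w : ℝ)) := by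
      rw [Real.rpow_mul (by norm_num), Real.rpow_natCast]; norm_num
    rw [h4, ht, ← Real.rpow_mul (by norm_num), ← Real.rpow_add (by norm_num), hε]
    congr 1
    ring

end DecisionList

/-! ### Counting the functions computed by small decision lists. -/

namespace DecisionList

/-- The decision list computing the disjunction of the terms in `T`. -/
noncomputable def ofTerms {n : ℕ} (T : Finset (ConjTerm n)) : DecisionList n Bool where
  size := T.card + 1
  size_pos := Nat.succ_pos _
  term := fun i => if h : (i : ℕ) < T.card then (T.equivFin.symm ⟨i, h⟩).1 else fun _ => none
  value := fun i => decide ((i : ℕ) < T.card)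
  default_sat := fun x => by simp [ConjTerm.Sat]

theorem eval_ofTerms_iff {n : ℕ} (T : Finset (ConjTerm n)) (x : Fin n → Bool) :
    (ofTerms T).eval x = true ↔ ∃ C ∈ T, C.Sat x := by
  have hval : (ofTerms T).eval x = true ↔ ((ofTerms T).index x : ℕ) < T.card := by
    simp [eval, ofTerms]
  have hterm : ∀ (i : Fin (ofTerms T).size) (h : (i : ℕ) < T.card),
      (ofTerms T).term i = (T.equivFin.symm ⟨i, h⟩).1 := by
    intro i h
    simp [ofTerms, h]
  rw [hval]
  constructor
  · intro h
    refine ⟨_, (T.equivFin.symm ⟨_, h⟩).2, ?_⟩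
    rw [← hterm _ h]
    exact sat_index _ x
  · rintro ⟨C, hC, hx⟩
    have hlt := (T.equivFin ⟨C, hC⟩).isLt
    set i : Fin (ofTerms T).size := ⟨T.equivFin ⟨C, hC⟩, Nat.lt_succ_of_lt hlt⟩ with hi
    have : (ofTerms T).index x ≤ i := by
      apply index_le
      rw [hterm i hlt]
      simpa [hi] using hx
    exact lt_of_le_of_lt (Fin.le_def.1 this) hlt

theorem width_ofTerms_le {n w : ℕ} {T : Finset (ConjTerm n)} (hT : ∀ C ∈ T, C.width ≤ w) :
    (ofTerms T).width ≤ w := by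
  apply Finset.sup_le
  intro i _
  by_cases h : (i : ℕ) < T.card
  · have e : (ofTerms T).term i = (T.equivFin.symm ⟨i, h⟩).1 := by simp [ofTerms, h]
    change ((ofTerms T).term i).width ≤ w
    rw [e]
    exact hT _ (T.equivFin.symm ⟨i, h⟩).2
  · simp [ofTerms, h, ConjTerm.width]

end DecisionList

/-- Raising the width by one either keeps a term or sets one of `n` variables to one of two bits,
which multiplies the count by at most `2n + 1`. -/
theorem ConjTerm.exists_finset_width_le (n w : ℕ) :
    ∃ T : Finset (Fin n → Option Bool), T.card ≤ (2 * n + 1) ^ w ∧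
      ∀ C : Fin n → Option Bool, ConjTerm.width C ≤ w → C ∈ T := by
  classical
  induction w with
  | zero =>
    refine ⟨{fun _ => none}, by simp, fun C hC => ?_⟩
    simp only [nonpos_iff_eq_zero, ConjTerm.width, Finset.card_eq_zero,
      Finset.filter_eq_empty_iff, Finset.mem_univ, true_implies] at hC
    rw [Finset.mem_singleton]
    funext i
    simpa using hC (x := i)
  | succ w ih =>
    obtain ⟨T, hcard, hT⟩ := ih
    refine ⟨T ∪ Finset.image₂ (fun (C : Fin n → Option Bool) (p : Fin n × Bool) =>
      Function.update C p.1 (some p.2)) T Finset.univ, ?_, fun C hC => ?_⟩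
    · refine (Finset.card_union_le _ _).trans ?_
      have := Finset.card_image₂_le (fun (C : Fin n → Option Bool) (p : Fin n × Bool) =>
        Function.update C p.1 (some p.2)) T Finset.univ
      simp only [Finset.card_univ, Fintype.card_prod, Fintype.card_fin, Fintype.card_bool] at this
      rw [pow_succ]
      nlinarith
    · by_cases h : ConjTerm.width C ≤ w
      · exact Finset.mem_union_left _ (hT C h)
      apply Finset.mem_union_right
      have hne : (Finset.univ.filter (fun i : Fin n => (C i).isSome = true)).Nonempty := by
        rw [← Finset.card_pos]
        exact Nat.pos_of_ne_zero fun h0 => h (by simp [ConjTerm.width, h0])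
      obtain ⟨i, hi⟩ := hne
      obtain ⟨b, hb⟩ := Option.isSome_iff_exists.1 (Finset.mem_filter.1 hi).2
      refine Finset.mem_image₂.2 ⟨Function.update C i none, hT _ ?_, (i, b), Finset.mem_univ _, ?_⟩
      · have hsub : Finset.univ.filter
            (fun j : Fin n => (Function.update C i none j).isSome = true) ⊆
            (Finset.univ.filter (fun j : Fin n => (C j).isSome = true)).erase i := by
          intro j hj
          rw [Finset.mem_filter] at hj
          by_cases hji : j = i
          · subst hji
            simp at hj
          · simp only [Function.update_of_ne hji] at hj
            simp [hji, hj.2]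
        have := Finset.card_le_card hsub
        rw [Finset.card_erase_of_mem hi] at this
        simp only [ConjTerm.width] at hC ⊢
        omega
      · simp [← hb]

/-- The value of the first rule of `c` whose term is satisfied by `x`, or `false` if there is no
such rule. -/
def firstMatch {n s : ℕ} (c : Fin s → ConjTerm n × Bool) (x : Fin n → Bool) : Bool :=
  if h : (Finset.univ.filter (fun i => (c i).1.Sat x)).Nonempty then
    (c ((Finset.univ.filter (fun i => (c i).1.Sat x)).min' h)).2
  else false

theorem firstMatch_eq {n s : ℕ} {c : Fin s → ConjTerm n × Bool} {x : Fin n → Bool} {i : Fin s}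
    (hi : (c i).1.Sat x) (hmin : ∀ j, (c j).1.Sat x → i ≤ j) : firstMatch c x = (c i).2 := by
  have hmem : i ∈ Finset.univ.filter (fun i => (c i).1.Sat x) := by simpa using hi
  rw [firstMatch, dif_pos ⟨i, hmem⟩]
  congr 2
  apply le_antisymm (Finset.min'_le _ _ hmem)
  exact Finset.le_min' _ _ _ fun j hj => hmin j (Finset.mem_filter.1 hj).2

theorem DecisionList.exists_finset_eval (n w s : ℕ) :
    ∃ G : Finset ((Fin n → Bool) → Bool), G.card ≤ (2 * (2 * n + 1) ^ w) ^ s ∧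
      ∀ L : DecisionList n Bool, L.width ≤ w → L.size ≤ s → L.eval ∈ G := by
  classical
  obtain ⟨T, hcard, hT⟩ : ∃ T : Finset (ConjTerm n), T.card ≤ (2 * n + 1) ^ w ∧
    ∀ C : ConjTerm n, C.width ≤ w → C ∈ T := ConjTerm.exists_finset_width_le n w
  refine ⟨(Fintype.piFinset fun _ : Fin s => T ×ˢ (Finset.univ : Finset Bool)).image
    (fun c => firstMatch (n := n) c), ?_, fun L hw hs => ?_⟩
  · refine Finset.card_image_le.trans ?_
    simp only [Fintype.card_piFinset, Finset.card_product, Finset.card_univ, Fintype.card_bool,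
      Finset.prod_const, Fintype.card_fin]
    rw [mul_comm]
    gcongr
  -- Shorter lists are padded to length `s` by repeating the default rule, so the default `false` of
  -- `firstMatch` never matters here.
  · set e : Fin s → Fin L.size := fun i => if h : (i : ℕ) < L.size then ⟨i, h⟩ else L.last with he
    refine Finset.mem_image.2 ⟨fun i => (L.term (e i), L.value (e i)), ?_, ?_⟩
    · rw [Fintype.mem_piFinset]
      intro i
      rw [Finset.mem_product]
      refine ⟨hT _ ?_, Finset.mem_univ _⟩
      exact (Finset.le_sup (f := fun i => (L.term i).width) (Finset.mem_univ _)).trans hw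
    · funext x
      set i : Fin s := ⟨L.index x, (L.index x).isLt.trans_le hs⟩ with hi
      have hei : e i = L.index x := by simp [he, hi]
      rw [firstMatch_eq (i := i)]
      · change L.value (e i) = L.value (L.index x)
        rw [hei]
      · change (L.term (e i)).Sat x
        rw [hei]
        exact L.sat_index x
      · intro j hj
        have h1 : L.index x ≤ e j := L.index_le hj
        have h2 : ((e j : Fin L.size) : ℕ) ≤ j := by
          by_cases h : (j : ℕ) < L.size
          · simp [he, h]
          · simp only [he, h, dite_false]
            exact (L.last.isLt.le).trans (not_lt.1 h)
        exact (Fin.le_def.1 h1).trans h2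

/-! ### Constant error: covering by Hamming balls. -/

/-- Weight each `f` by `(1/2)` to the power of its distance from `g`. The total weight is `(3/2)^N`,
and each point of the ball weighs at least `(1/2)^(N/3)`. Cubing removes the fractional exponent. -/
theorem card_hammingBall_pow_le {X : Type*} [Fintype X] [DecidableEq X] (g : X → Bool) :
    (((Finset.univ : Finset (X → Bool)).filter
      (fun f => 3 * (Finset.univ.filter (fun x => g x ≠ f x)).card ≤ Fintype.card X)).card : ℝ) ^ 3
      ≤ (27 / 4) ^ Fintype.card X := by
  set N := Fintype.card X with hN
  set B := (Finset.univ : Finset (X → Bool)).filter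
      (fun f => 3 * (Finset.univ.filter (fun x => g x ≠ f x)).card ≤ N) with hB
  have htotal : ∑ f : X → Bool, (1 / 2 : ℝ) ^ (Finset.univ.filter (fun x => g x ≠ f x)).card =
      (3 / 2) ^ N := by
    have : ∀ f : X → Bool, (1 / 2 : ℝ) ^ (Finset.univ.filter (fun x => g x ≠ f x)).card =
        ∏ x, if g x ≠ f x then (1 / 2 : ℝ) else 1 := by
      intro f
      rw [Finset.prod_ite]
      simp
    simp_rw [this]
    rw [← Fintype.prod_sum (fun x b => if g x ≠ b then (1 / 2 : ℝ) else 1)]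
    rw [Finset.prod_eq_pow_card (b := (3 / 2 : ℝ)), Finset.card_univ]
    intro x _
    rw [Fintype.sum_bool]
    cases g x <;> norm_num
  set y : ℝ := (1 / 2 : ℝ) ^ ((N : ℝ) / 3) with hy
  have hy0 : 0 < y := by positivity
  have hy3 : y ^ 3 = (1 / 2) ^ N := by
    rw [hy, ← Real.rpow_natCast, ← Real.rpow_mul (by norm_num), ← Real.rpow_natCast]
    congr 1
    push_cast
    ring
  have hle : (B.card : ℝ) * y ≤ (3 / 2) ^ N := by
    rw [← htotal, ← nsmul_eq_mul]
    refine (Finset.card_nsmul_le_sum B _ y ?_).trans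
      (Finset.sum_le_sum_of_subset_of_nonneg (Finset.subset_univ _) fun _ _ _ => by positivity)
    intro f hf
    rw [← Real.rpow_natCast, hy]
    apply Real.rpow_le_rpow_of_exponent_ge (by norm_num) (by norm_num)
    rw [le_div_iff₀ (by norm_num)]
    have := (Finset.mem_filter.1 hf).2
    have : ((3 * (Finset.univ.filter (fun x => g x ≠ f x)).card : ℕ) : ℝ) ≤ N := by
      exact_mod_cast this
    push_cast at this
    linarith
  have h3 := pow_le_pow_left₀ (by positivity) hle 3
  rw [mul_pow, hy3, ← pow_mul, mul_comm N 3, pow_mul] at h3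
  have e : ((27 : ℝ) / 4) ^ N * (1 / 2) ^ N = ((3 / 2) ^ 3) ^ N := by
    rw [← mul_pow]
    norm_num
  rw [← e] at h3
  exact le_of_mul_le_mul_right h3 (by positivity)

namespace DecisionList

theorem disagreement_eq {n : ℕ} (L L' : DecisionList n Bool) :
    L.disagreement L' =
      ((Finset.univ.filter (fun x => L.eval x ≠ L'.eval x)).card : ℝ) / 2 ^ n := by
  unfold disagreement
  congr!

/-- A full term on all `w` variables has width `w` and isolates one input. -/
theorem exists_eval_eq {w : ℕ} (f : (Fin w → Bool) → Bool) :
    ∃ L : DecisionList w Bool, L.width ≤ w ∧ L.eval = f := by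
  classical
  refine ⟨ofTerms ((Finset.univ.filter (fun x => f x = true)).image
    (fun x => (fun i => some (x i) : ConjTerm w))), width_ofTerms_le fun C _ => ?_, ?_⟩
  · exact (Finset.card_filter_le _ _).trans (by simp)
  · funext x
    rw [Bool.eq_iff_iff, eval_ofTerms_iff]
    constructor
    · rintro ⟨C, hC, hx⟩
      obtain ⟨y, hy, rfl⟩ := Finset.mem_image.1 hC
      have : x = y := funext fun i => hx i (y i) rfl
      rw [this]
      exact (Finset.mem_filter.1 hy).2
    · intro hx
      refine ⟨_, Finset.mem_image_of_mem _ (Finset.mem_filter.2 ⟨Finset.mem_univ x, hx⟩), ?_⟩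
      intro i b hb
      exact Option.some.inj hb

/-- The balls of radius `1/3` around the functions with small lists cover all `2^(2^w)` functions;
each ball holds at most a `(27/32)^(2^w/3)` fraction of them. -/
theorem two_pow_le_of_forall_approximates {w s : ℕ} {ε : ℝ} (hε : ε ≤ 1 / 3)
    (H : ∀ L : DecisionList w Bool, L.width ≤ w →
      ∃ L' : DecisionList w Bool, L'.width ≤ w ∧ Approximates ε L' L ∧ L'.size ≤ s) :
    2 ^ 2 ^ w ≤ (2 * (2 * w + 1) ^ w) ^ (15 * s) := by
  classical
  obtain ⟨G, hG, hmem⟩ := exists_finset_eval w w s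
  have hcardX : Fintype.card (Fin w → Bool) = 2 ^ w := by simp
  set B : ((Fin w → Bool) → Bool) → Finset ((Fin w → Bool) → Bool) := fun g =>
    Finset.univ.filter (fun f => 3 * (Finset.univ.filter (fun x => g x ≠ f x)).card ≤
      Fintype.card (Fin w → Bool)) with hB
  have hcover : (Finset.univ : Finset ((Fin w → Bool) → Bool)) ⊆ G.biUnion B := by
    intro f _
    obtain ⟨L, hL, rfl⟩ := exists_eval_eq f
    obtain ⟨L', hL', happ, hs⟩ := H L hL
    refine Finset.mem_biUnion.2 ⟨L'.eval, hmem L' hL' hs, Finset.mem_filter.2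
      ⟨Finset.mem_univ _, ?_⟩⟩
    have h : L.disagreement L' ≤ 1 / 3 := happ.trans hε
    rw [disagreement_eq] at h
    rw [div_le_iff₀ (by positivity)] at h
    rw [hcardX]
    have e : (Finset.univ.filter (fun x => L'.eval x ≠ L.eval x)).card =
        (Finset.univ.filter (fun x => L.eval x ≠ L'.eval x)).card := by
      simp only [ne_comm]
    rw [e]
    have : (3 : ℝ) * ((Finset.univ.filter (fun x => L.eval x ≠ L'.eval x)).card : ℝ) ≤ 2 ^ w := by
      linarith
    exact_mod_cast this
  set Y : ℝ := ((27 / 4 : ℝ) ^ 2 ^ w) ^ (1 / 3 : ℝ) with hY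
  have hY3 : Y ^ 3 = (27 / 4) ^ 2 ^ w := by
    rw [hY, ← Real.rpow_natCast, ← Real.rpow_mul (by positivity)]
    norm_num
  have hY0 : 0 < Y := by positivity
  have hball : ∀ g, ((B g).card : ℝ) ≤ Y := by
    intro g
    have := card_hammingBall_pow_le g
    rw [hcardX, ← hY3] at this
    rw [← hcardX] at this
    exact (pow_le_pow_iff_left₀ (by positivity) hY0.le three_ne_zero).1 this
  have hN : (2 : ℝ) ^ 2 ^ w ≤ G.card * Y := by
    have h1 := (Finset.card_le_card hcover).trans Finset.card_biUnion_le
    have h2 : Fintype.card ((Fin w → Bool) → Bool) = 2 ^ 2 ^ w := by simp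
    rw [Finset.card_univ, h2] at h1
    have h1' : (2 : ℝ) ^ 2 ^ w ≤ ∑ g ∈ G, ((B g).card : ℝ) := by exact_mod_cast h1
    refine h1'.trans ((Finset.sum_le_card_nsmul G _ Y fun g _ => hball g).trans ?_)
    rw [nsmul_eq_mul]
  have h3 := pow_le_pow_left₀ (by positivity) hN 3
  rw [mul_pow, hY3] at h3
  have e1 : ((2 : ℝ) ^ 2 ^ w) ^ 3 = (32 / 27) ^ 2 ^ w * (27 / 4) ^ 2 ^ w := by
    rw [← mul_pow, ← pow_mul, mul_comm (2 ^ w) 3, pow_mul]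
    norm_num
  rw [e1] at h3
  have h4 : ((32 : ℝ) / 27) ^ 2 ^ w ≤ (G.card : ℝ) ^ 3 :=
    le_of_mul_le_mul_right h3 (by positivity)
  -- The exponent 15 is `3 * 5`: cubing as above, and `2 ≤ (32/27)^5`.
  have h5 : (2 : ℝ) ^ 2 ^ w ≤ (G.card : ℝ) ^ 15 := by
    calc (2 : ℝ) ^ 2 ^ w ≤ ((32 / 27) ^ 5) ^ 2 ^ w := by gcongr; norm_num
      _ = ((32 / 27) ^ 2 ^ w) ^ 5 := by rw [← pow_mul, ← pow_mul, mul_comm]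
      _ ≤ ((G.card : ℝ) ^ 3) ^ 5 := by gcongr
      _ = (G.card : ℝ) ^ 15 := by rw [← pow_mul]
  have h6 : 2 ^ 2 ^ w ≤ G.card ^ 15 := by exact_mod_cast h5
  refine h6.trans ((Nat.pow_le_pow_left hG 15).trans (le_of_eq ?_))
  rw [← pow_mul, mul_comm s]

/-! ### Tiny error: exact computation and transversal terms. -/

theorem eval_eq_of_approximates {n : ℕ} {ε : ℝ} (hε : ε < 1 / 2 ^ n) {L L' : DecisionList n Bool}
    (h : Approximates ε L' L) : L'.eval = L.eval := by
  have h : L.disagreement L' < 1 / 2 ^ n := h.trans_lt hε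
  rw [disagreement_eq] at h
  rw [div_lt_div_iff_of_pos_right (by positivity)] at h
  have h0 : _ = 0 := Nat.lt_one_iff.1 (by exact_mod_cast h)
  rw [Finset.card_eq_zero, Finset.filter_eq_empty_iff] at h0
  funext x
  have := h0 (Finset.mem_univ x)
  push Not at this
  exact this.symm

end DecisionList

/-- The monotone term that picks the variable `s j` out of the `j`-th of `w` blocks of `q`
variables. -/
def transversalTerm {w q : ℕ} (s : Fin w → Fin q) : ConjTerm (w * q) := fun i =>
  if s (finProdFinEquiv.symm i).1 = (finProdFinEquiv.symm i).2 then some true else none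

theorem width_transversalTerm_le {w q : ℕ} (s : Fin w → Fin q) :
    (transversalTerm s).width ≤ w := by
  have hsub : Finset.univ.filter (fun i => (transversalTerm s i).isSome = true) ⊆
      Finset.univ.image (fun j : Fin w => finProdFinEquiv (j, s j)) := by
    intro i hi
    have hi := (Finset.mem_filter.1 hi).2
    refine Finset.mem_image.2 ⟨(finProdFinEquiv.symm i).1, Finset.mem_univ _, ?_⟩
    have : s (finProdFinEquiv.symm i).1 = (finProdFinEquiv.symm i).2 := by
      by_contra h
      rw [transversalTerm, if_neg h] at hi
      simp at hi
    rw [this]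
    exact finProdFinEquiv.apply_symm_apply i
  refine (Finset.card_le_card hsub).trans (Finset.card_image_le.trans ?_)
  simp

/-- The indicator of the variables in `transversalTerm s`. -/
def transversalPoint {w q : ℕ} (s : Fin w → Fin q) : Fin (w * q) → Bool := fun i =>
  decide (s (finProdFinEquiv.symm i).1 = (finProdFinEquiv.symm i).2)

theorem sat_transversalPoint_iff {w q : ℕ} (s s' : Fin w → Fin q) :
    (transversalTerm s).Sat (transversalPoint s') ↔ s = s' := by
  constructor
  · intro h
    funext j
    have := h (finProdFinEquiv (j, s j)) true (by simp [transversalTerm])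
    simpa [transversalPoint, eq_comm] using this
  · rintro rfl i b hb
    by_cases h : s (finProdFinEquiv.symm i).1 = (finProdFinEquiv.symm i).2
    · rw [transversalTerm, if_pos h, Option.some.injEq] at hb
      rw [transversalPoint, decide_eq_true h, hb]
    · rw [transversalTerm, if_neg h] at hb
      simp at hb

namespace DecisionList

/-- A set `S` of transversals is recovered from the disjunction of its terms, since the indicator
point of a transversal satisfies no other transversal term. -/
theorem two_pow_le_of_forall_eval_eq {w q s : ℕ}
    (H : ∀ L : DecisionList (w * q) Bool, L.width ≤ w →
      ∃ L' : DecisionList (w * q) Bool, L'.width ≤ w ∧ L'.eval = L.eval ∧ L'.size ≤ s) :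
    2 ^ q ^ w ≤ (2 * (2 * (w * q) + 1) ^ w) ^ s := by
  classical
  obtain ⟨G, hG, hmem⟩ := exists_finset_eval (w * q) w s
  refine le_trans ?_ hG
  set F : Finset (Fin w → Fin q) → DecisionList (w * q) Bool := fun S =>
    ofTerms (S.image transversalTerm) with hF
  have hinj : Function.Injective (fun S => (F S).eval) := by
    intro S S' h
    have key : ∀ S s, (F S).eval (transversalPoint s) = true ↔ s ∈ S := by
      intro S s
      rw [hF, eval_ofTerms_iff]
      simp [sat_transversalPoint_iff]
    ext s
    rw [← key S, ← key S']
    exact iff_of_eq (congrArg (fun f => f (transversalPoint s) = true) h)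
  have hcard : Fintype.card (Finset (Fin w → Fin q)) = 2 ^ q ^ w := by simp
  rw [← hcard, ← Finset.card_univ]
  refine Finset.card_le_card_of_injOn (fun S => (F S).eval) (fun S _ => ?_) hinj.injOn
  obtain ⟨L', hw, he, hs⟩ := H (F S) (width_ofTerms_le fun C hC => by
    obtain ⟨s, -, rfl⟩ := Finset.mem_image.1 hC
    exact width_transversalTerm_le s)
  change (F S).eval ∈ G
  rw [← he]
  exact hmem L' hw hs

/-! ### The lower bound in each range of parameters. -/

/-- A balanced function is not approximated by a decision list of size one. -/
theorem one_lt_size_of_approximates {ε : ℝ} (hε : ε ≤ 1 / 3) {L L' : DecisionList 1 Bool}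
    (hL : ∀ x, L.eval x = x 0) (h : Approximates ε L' L) : 1 < L'.size := by
  classical
  by_contra! hs
  have h1 : L'.size = 1 := le_antisymm hs L'.size_pos
  have hsub : Subsingleton (Fin L'.size) := by
    rw [h1]
    infer_instance
  have hne : (Finset.univ.filter (fun x => L.eval x ≠ L'.eval x)).Nonempty := by
    by_contra hempty
    rw [Finset.not_nonempty_iff_eq_empty, Finset.filter_eq_empty_iff] at hempty
    have ht := hempty (Finset.mem_univ (fun _ => true))
    have hf := hempty (Finset.mem_univ (fun _ => false))
    push Not at ht hf
    rw [hL] at ht hf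
    have : L'.eval (fun _ => true) = L'.eval (fun _ => false) :=
      congrArg L'.value (Subsingleton.elim _ _)
    rw [← ht, ← hf] at this
    exact absurd this (by decide)
  have hc : (1 : ℝ) ≤ (Finset.univ.filter (fun x => L.eval x ≠ L'.eval x)).card := by
    exact_mod_cast Finset.card_pos.2 hne
  have h : L.disagreement L' ≤ 1 / 3 := h.trans hε
  rw [disagreement_eq] at h
  rw [pow_one, div_le_iff₀ (by norm_num)] at h
  linarith

theorem exists_hard_of_small_width {w : ℕ} (hw : 1 ≤ w) {ε X : ℝ} (hε : ε ≤ 1 / 3) (hX : X < 2) :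
    ∃ (n : ℕ) (L : DecisionList n Bool), L.width ≤ w ∧
      ∀ L' : DecisionList n Bool, L'.width ≤ w → Approximates ε L' L → X < L'.size := by
  obtain ⟨L, hLw, hL⟩ := exists_eval_eq (w := 1) (fun x => x 0)
  refine ⟨1, L, hLw.trans hw, fun L' _ h => hX.trans_le ?_⟩
  exact_mod_cast one_lt_size_of_approximates hε (fun x => congrFun hL x) h

/-- Counting forces `2^w ≤ 45 * w^2 * s`, whereas `s ≤ 2^(w/2)`; squaring contradicts `2025 * w^4 <
2^w`, which holds from `w = 32` on. -/
theorem exists_hard_of_large_width {w : ℕ} (hw : 32 ≤ w) {ε X : ℝ} (hε : ε ≤ 1 / 3) (h0 : 0 ≤ X)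
    (hX : X ^ 2 ≤ 2 ^ w) :
    ∃ (n : ℕ) (L : DecisionList n Bool), L.width ≤ w ∧
      ∀ L' : DecisionList n Bool, L'.width ≤ w → Approximates ε L' L → X < L'.size := by
  by_contra! H
  have h := two_pow_le_of_forall_approximates (w := w) (s := ⌊X⌋₊) hε fun L hL => by
    obtain ⟨L', h1, h2, h3⟩ := H w L hL
    exact ⟨L', h1, h2, Nat.le_floor h3⟩
  set s := ⌊X⌋₊ with hs
  have hs2 : s ^ 2 ≤ 2 ^ w := by
    have : (s : ℝ) ^ 2 ≤ 2 ^ w := (pow_le_pow_left₀ (by positivity) (Nat.floor_le h0) 2).trans hX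
    exact_mod_cast this
  have hbase : 2 * (2 * w + 1) ^ w ≤ 2 ^ (1 + (w + 1) * w) := by
    rw [pow_add, pow_one, pow_mul]
    gcongr
    have := Nat.lt_two_pow_self (n := w)
    rw [pow_succ]
    omega
  have h1 : 2 ^ 2 ^ w ≤ 2 ^ ((1 + (w + 1) * w) * (15 * s)) := by
    rw [pow_mul]
    exact h.trans (Nat.pow_le_pow_left hbase _)
  have h2 : 2 ^ w ≤ (1 + (w + 1) * w) * (15 * s) := (Nat.pow_le_pow_iff_right (by norm_num)).1 h1
  have h3 : 2 ^ w ≤ 45 * w ^ 2 * s := by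
    refine h2.trans ?_
    have : 1 + (w + 1) * w ≤ 3 * w ^ 2 := by nlinarith
    calc (1 + (w + 1) * w) * (15 * s) ≤ 3 * w ^ 2 * (15 * s) := by gcongr
      _ = 45 * w ^ 2 * s := by ring
  have h4 : 2025 * w ^ 4 < 2 ^ w := by
    clear * - hw
    induction w, hw using Nat.le_induction with
    | base => norm_num
    | succ m hm ih =>
      rw [pow_succ 2]
      have : (m + 1) ^ 4 ≤ 2 * m ^ 4 := by
        have e : (m + 1) ^ 4 = m ^ 4 + 4 * m ^ 3 + 6 * m ^ 2 + 4 * m + 1 := by ring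
        nlinarith [pow_pos (show 0 < m by omega) 3, pow_pos (show 0 < m by omega) 2]
      omega
  have h5 : 2 ^ w * 2 ^ w ≤ 2025 * w ^ 4 * 2 ^ w := by
    calc 2 ^ w * 2 ^ w ≤ (45 * w ^ 2 * s) * (45 * w ^ 2 * s) := Nat.mul_le_mul h3 h3
      _ = 2025 * w ^ 4 * s ^ 2 := by ring
      _ ≤ _ := by gcongr
  have := Nat.le_of_mul_le_mul_right h5 (by positivity)
  omega

/-- Blocks of size `q = 2^r` give `2^(2^(r*w))` functions, so `2^(r*w) ≤ (r+3) * w^2 * s`, which is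
impossible for `s ≤ 2^(r*w/2)`. -/
theorem exists_hard_of_small_error {w r : ℕ} (hw : 1 ≤ w) (hr : 10 ≤ r) {ε X : ℝ}
    (hε : ε < 1 / 2 ^ (w * 2 ^ r)) (h0 : 0 ≤ X) (hX : X ^ 2 ≤ 2 ^ (r * w)) :
    ∃ (n : ℕ) (L : DecisionList n Bool), L.width ≤ w ∧
      ∀ L' : DecisionList n Bool, L'.width ≤ w → Approximates ε L' L → X < L'.size := by
  by_contra! H
  have h := two_pow_le_of_forall_eval_eq (w := w) (q := 2 ^ r) (s := ⌊X⌋₊) fun L hL => by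
    obtain ⟨L', h1, h2, h3⟩ := H _ L hL
    exact ⟨L', h1, eval_eq_of_approximates hε h2, Nat.le_floor h3⟩
  set s := ⌊X⌋₊ with hs
  have hs2 : s ^ 2 ≤ 2 ^ (r * w) := by
    have : (s : ℝ) ^ 2 ≤ 2 ^ (r * w) :=
      (pow_le_pow_left₀ (by positivity) (Nat.floor_le h0) 2).trans hX
    exact_mod_cast this
  -- The saving over `w < 2^w` matters: `w^4 ≤ 2^(4*(w-1)) ≤ 2^(r*(w-1))` leaves a whole factor
  -- `2^r` to beat `(r+3)^2`.
  have hw2 : w ≤ 2 ^ (w - 1) := by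
    have := Nat.lt_two_pow_self (n := w - 1)
    omega
  have hbase : 2 * (2 * (w * 2 ^ r) + 1) ^ w ≤ 2 ^ (1 + (w + r + 1) * w) := by
    rw [pow_add, pow_one, pow_mul]
    gcongr
    have h1 := Nat.lt_two_pow_self (n := w)
    have h2 : 1 ≤ 2 ^ r := Nat.one_le_two_pow
    rw [pow_succ, pow_add]
    nlinarith
  have h1 : 2 ^ 2 ^ (r * w) ≤ 2 ^ ((1 + (w + r + 1) * w) * s) := by
    rw [pow_mul 2 _ s, pow_mul 2 r w]
    exact h.trans (Nat.pow_le_pow_left hbase _)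
  have h2 : 2 ^ (r * w) ≤ (1 + (w + r + 1) * w) * s := (Nat.pow_le_pow_iff_right (by norm_num)).1 h1
  have h3 : 1 + (w + r + 1) * w ≤ (r + 3) * w ^ 2 := by
    have h := Nat.mul_le_mul_left (r + 1) (Nat.le_self_pow two_ne_zero w)
    nlinarith
  have h4 : (r + 3) ^ 2 < 2 ^ r := by
    clear * - hr
    induction r, hr using Nat.le_induction with
    | base => norm_num
    | succ m hm ih =>
      rw [pow_succ 2]
      nlinarith
  have h5 : (r + 3) ^ 2 * w ^ 4 < 2 ^ (r * w) := by
    obtain ⟨v, rfl⟩ : ∃ v, w = v + 1 := ⟨w - 1, by omega⟩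
    simp only [Nat.add_sub_cancel] at hw2
    calc (r + 3) ^ 2 * (v + 1) ^ 4 ≤ (r + 3) ^ 2 * (2 ^ v) ^ 4 := by gcongr
      _ < 2 ^ r * (2 ^ v) ^ 4 := by gcongr
      _ = 2 ^ r * 2 ^ (4 * v) := by rw [← pow_mul, mul_comm v]
      _ ≤ 2 ^ r * 2 ^ (r * v) := by gcongr <;> omega
      _ = 2 ^ (r * (v + 1)) := by rw [← pow_add]; ring_nf
  have h6 : 2 ^ (r * w) * 2 ^ (r * w) ≤ (r + 3) ^ 2 * w ^ 4 * 2 ^ (r * w) := by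
    have h2' : 2 ^ (r * w) ≤ (r + 3) * w ^ 2 * s := h2.trans (by gcongr)
    calc 2 ^ (r * w) * 2 ^ (r * w) ≤ ((r + 3) * w ^ 2 * s) * ((r + 3) * w ^ 2 * s) :=
          Nat.mul_le_mul h2' h2'
      _ = (r + 3) ^ 2 * w ^ 4 * s ^ 2 := by ring
      _ ≤ _ := by gcongr
  have := Nat.le_of_mul_le_mul_right h6 (by positivity)
  omega

theorem exists_hard {w : ℕ} (hw : 1 ≤ w) {ε : ℝ} (h0 : 0 < ε) (h1 : ε ≤ 1 / 3) :
    ∃ (n : ℕ) (L : DecisionList n Bool), L.width ≤ w ∧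
      ∀ L' : DecisionList n Bool, L'.width ≤ w → Approximates ε L' L →
        (2 + 1 / (w : ℝ) * Real.logb 2 (1 / ε)) ^ (1 / 1000 * (w : ℝ)) < (L'.size : ℝ) := by
  have hwpos : (0 : ℝ) < w := by exact_mod_cast hw
  set k : ℝ := 1 / (w : ℝ) * Real.logb 2 (1 / ε) with hk
  have hk0 : 0 ≤ k := by
    have : 0 ≤ Real.logb 2 (1 / ε) :=
      Real.logb_nonneg (by norm_num) ((one_le_div h0).2 (by linarith))
    positivity
  have hε : ε = (2 : ℝ) ^ (-(k * w)) := by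
    have : k * w = - Real.logb 2 ε := by
      rw [hk, one_div ε, Real.logb_inv]; field_simp
    rw [this, neg_neg, Real.rpow_logb (by norm_num) (by norm_num) h0]
  have hXle : ∀ a : ℕ, 2 + k ≤ 2 ^ a →
      (2 + k) ^ (1 / 1000 * (w : ℝ)) ≤ (2 : ℝ) ^ ((a : ℝ) * w / 1000) := by
    intro a ha
    refine (Real.rpow_le_rpow (by positivity) ha (by positivity)).trans (le_of_eq ?_)
    rw [← Real.rpow_natCast, ← Real.rpow_mul (by norm_num)]
    congr 1
    ring
  have hsq : ∀ a b : ℕ, 2 + k ≤ 2 ^ a → (a : ℝ) * w / 500 ≤ b →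
      ((2 + k) ^ (1 / 1000 * (w : ℝ))) ^ 2 ≤ 2 ^ b := by
    intro a b ha hab
    refine (pow_le_pow_left₀ (by positivity) (hXle a ha) 2).trans ?_
    rw [← Real.rpow_natCast, ← Real.rpow_mul (by norm_num), ← Real.rpow_natCast]
    apply Real.rpow_le_rpow_of_exponent_le (by norm_num)
    push_cast
    linarith
  -- Below `2^11` the base is at most `2^12`, so the exponent `w/1000` keeps the bound below 2 when
  -- `w < 32` and below `2^(w/2)` otherwise.
  rcases lt_or_ge k (2 ^ 11) with hlt | hge
  · have ha : 2 + k ≤ 2 ^ 12 := by norm_num at hlt ⊢; linarith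
    rcases lt_or_ge w 32 with hw32 | hw32
    · refine exists_hard_of_small_width hw h1 ((hXle 12 ha).trans_lt ?_)
      have hw32' : (w : ℝ) < 32 := by exact_mod_cast hw32
      calc (2 : ℝ) ^ (((12 : ℕ) : ℝ) * w / 1000) < 2 ^ (1 : ℝ) := by
            apply Real.rpow_lt_rpow_of_exponent_lt (by norm_num)
            push_cast
            linarith
        _ = 2 := Real.rpow_one 2
    · refine exists_hard_of_large_width hw32 h1 (by positivity) (hsq 12 w ha ?_)
      push_cast
      linarith
  -- Here `2^r ≤ k/2 < 2^(r+1)`. The first inequality makes `ε = 2^(-k*w)` less than the mass of one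
  -- input on `w * 2^r` variables; the second gives `2 + k ≤ 2^(r+3)`.
  · obtain ⟨r, hr1, hr2⟩ := exists_nat_pow_near (x := k / 2) (y := 2)
      (by norm_num at hge ⊢; linarith) (by norm_num)
    have hr10 : 10 ≤ r := by
      have : (2 : ℝ) ^ 10 < 2 ^ (r + 1) := by
        refine lt_of_le_of_lt ?_ hr2
        norm_num at hge ⊢
        linarith
      have := (pow_lt_pow_iff_right₀ (by norm_num)).1 this
      omega
    refine exists_hard_of_small_error hw hr10 ?_ (by positivity) (hsq (r + 3) (r * w) ?_ ?_)
    · rw [hε, one_div, ← Real.rpow_natCast, ← Real.rpow_neg (by norm_num)]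
      apply Real.rpow_lt_rpow_of_exponent_lt (by norm_num)
      push_cast
      have : (2 : ℝ) ^ r < k := by
        have : (0 : ℝ) < 2 ^ r := by positivity
        linarith
      nlinarith
    · have : (1 : ℝ) ≤ 2 ^ r := one_le_pow₀ (by norm_num)
      rw [pow_succ] at hr2
      rw [pow_add]
      linarith
    · have : (10 : ℝ) ≤ r := by exact_mod_cast hr10
      push_cast
      nlinarith

end DecisionList

theorem theorem1 :
    -- the upper bound, by keeping the rules in `J`
    (∃ C : ℝ, 0 < C ∧
      ∀ (w : ℕ) (ε : ℝ), 1 ≤ w → 0 < ε → ε ≤ 1 →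
        ∀ (n : ℕ) (V : Type*) (L : DecisionList n V), L.width ≤ w →
          ∃ (J : Finset (Fin L.size)) (hJ : L.last ∈ J),
            (L.restrict J hJ).width ≤ w ∧
            ((L.restrict J hJ).size : ℝ) ≤
              (2 + 1 / (w : ℝ) * Real.logb 2 (1 / ε)) ^ (C * (w : ℝ)) ∧
            DecisionList.Approximates ε (L.restrict J hJ) L) ∧
    -- optimality, against all width-`w` decision lists and not only sub-decision lists
    (∃ c : ℝ, 0 < c ∧
      ∀ (w : ℕ) (ε : ℝ), 1 ≤ w → 0 < ε → ε ≤ 1 / 3 →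
        ∃ (n : ℕ) (L : DecisionList n Bool), L.width ≤ w ∧
          ∀ L' : DecisionList n Bool, L'.width ≤ w →
            DecisionList.Approximates ε L' L →
              (2 + 1 / (w : ℝ) * Real.logb 2 (1 / ε)) ^ (c * (w : ℝ)) < (L'.size : ℝ)) := by
  refine ⟨⟨5, by norm_num, ?_⟩, ⟨1 / 1000, by norm_num, ?_⟩⟩
  · intro w ε hw h0 h1 n V L hL
    exact L.exists_restrict_approximates hw hL h0 h1
  · intro w ε hw h0 h1
    exact DecisionList.exists_hard hw h0 h1
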